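/- Let $\mathcal B=\{x\in\mathbb R^d:\|x\|\le 1\}$ be the closed Euclidean unit ball, $d\ge 1$. A set $R\subseteq\mathbb R^d$ *approximates $\mathcal B$ with error less than $\delta$* if for every $x\in\mathcal B$ there is $y\in R$ with $\|x-y\|<\delta$. For codes $z_1,\dots,z_m\in\mathbb R^d$, clustering-based quantization can output the vectors $\{z_1,\dots,z_m\}$, and sparse regression with at most $s$ nonzero weights can output the vectors $\sum_{i=1}^m w_iz_i$ with $w\in\mathbb R_{\ge 0}^m$ and $|\{i:w_i\neq0\}|\le s$. Let $T_{\rm cl}(\mathcal B,\delta)$, respectively $T_{s}(\mathcal B,\delta)$, be the least $m$ for which there are $m$ codes such that the set of possible outputs approximates $\mathcal B$ with error less than $\delta$. (i) For all $d\ge1$ and $\delta>0$, $T_{\rm cl}(\mathcal B,\delta)\ge 1/\delta^d$. (ii) There is an absolute constant $C>0$ for which the following two statements hold. (a) For all integers $1\le s\le m$ and all $0<\delta<1$, the set of unit vectors of $\mathbb R^m$ with at most $s$ nonzero coordinates has a $\delta$-net (contained in it) with at most $(Cm/(s\delta))^s$ elements. (b) Let $d\ge1$, $\delta,\varepsilon\in(0,1)$,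 let $p$ be a real number with $$p\ \ge\ \max\left(3,\ \frac{\log\log(2d/\varepsilon)}{\log(4/\delta)}\right),$$ and let $s$ be an integer with $$s\ \ge\ \frac{4d}{\delta\left(\log C+p\log(4d)-(p+1)\log\delta\right)}.$$ Then $T_{s}(\mathcal B,\delta)\le\lceil(4d/\delta)^p\rceil$. Moreover, if $d\ge2$, then for every integer $m\ge(4d/\delta)^p$ and independent random codes $u_1,\dots,u_m\sim\mathcal N(0,I_d/m)$, with probability at least $1-\varepsilon$, every $x\in\mathcal B$ is approximated with error less than $\delta$ by some $\sum_{i=1}^m w_iu_i$ with $w\in\mathbb R_{\ge 0}^m$ having at most $s$ nonzero entries. -/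

import Mathlib

open MeasureTheory ProbabilityTheory
open scoped NNReal ENNReal

/-- Every vector of the closed unit ball of `ℝ^d` is approximated by some element of the set `R` of
representable vectors with (Euclidean) error less than `δ`. -/
def ApproximatesBall {d : ℕ} (δ : ℝ) (R : Set (EuclideanSpace ℝ (Fin d))) : Prop :=
  ∀ x ∈ Metric.closedBall (0 : EuclideanSpace ℝ (Fin d)) 1, ∃ y ∈ R, ‖x - y‖ < δ

/-- The vectors that clustering-based quantization with codes `z` can output: a single code.
(A vector is sent to its nearest code, so its error is less than `δ` exactly when some code is at
distance less than `δ`.) -/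
def clusteringOutputs {d m : ℕ} (z : Fin m → EuclideanSpace ℝ (Fin d)) :
    Set (EuclideanSpace ℝ (Fin d)) :=
  Set.range z

/-- The vectors that sparse regression over the codes `z` can output: combinations
`∑ i, w i • z i` with nonnegative weights, at most `s` of which are nonzero. -/
def sparseOutputs {d m : ℕ} (s : ℕ) (z : Fin m → EuclideanSpace ℝ (Fin d)) :
    Set (EuclideanSpace ℝ (Fin d)) :=
  {y | ∃ w : Fin m → ℝ, (∀ i, 0 ≤ w i) ∧ {i | w i ≠ 0}.ncard ≤ s ∧ y = ∑ i, w i • z i}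

/-- `T(B, δ)` for clustering: the least number of codes with which every vector of the unit ball is
approximated with error less than `δ`. -/
noncomputable def clusteringT (d : ℕ) (δ : ℝ) : ℕ∞ :=
  ⨅ (m : ℕ) (_ : ∃ z : Fin m → EuclideanSpace ℝ (Fin d),
    ApproximatesBall δ (clusteringOutputs z)), (m : ℕ∞)

/-- `T(B, δ)` for sparse regression with at most `s` nonzero weights. -/
noncomputable def sparseT (d s : ℕ) (δ : ℝ) : ℕ∞ :=
  ⨅ (m : ℕ) (_ : ∃ z : Fin m → EuclideanSpace ℝ (Fin d),
    ApproximatesBall δ (sparseOutputs s z)), (m : ℕ∞)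

/-- The joint law of `m` independent random codes with law `𝒩(0, I_d / m)`. -/
noncomputable def gaussianCodes (d m : ℕ) : Measure (Fin m → EuclideanSpace ℝ (Fin d)) :=
  Measure.pi fun _ => multivariateGaussian 0 ((m : ℝ)⁻¹ • (1 : Matrix (Fin d) (Fin d) ℝ))

/-- The Euclidean unit vectors of `ℝ^m` with at most `s` nonzero coordinates. -/
def sparseUnitVectors (m s : ℕ) : Set (EuclideanSpace ℝ (Fin m)) :=
  {g | ‖g‖ = 1 ∧ {i | g i ≠ 0}.ncard ≤ s}

/-- `C` is a constant in the covering number bound for sparse unit vectors: for `1 ≤ s ≤ m` and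
`0 < δ < 1`, the `s`-sparse unit vectors of `ℝ^m` have a `δ`-net with at most `(C m / (s δ))^s`
elements. -/
def IsSparseCoveringConstant (C : ℝ) : Prop :=
  ∀ (m s : ℕ) (δ : ℝ≥0), 1 ≤ s → s ≤ m → 0 < δ → δ < 1 →
    ((Metric.coveringNumber δ (sparseUnitVectors m s) : ℕ∞) : ℝ≥0∞) ≤
      ENNReal.ofReal ((C * m / (s * δ)) ^ s)

/-! Clustering is a volume comparison: the balls of radius `δ` around the codes must cover the unit
ball. The covering constant is `C = 3e`: sparse unit vectors lie in `m.choose s` coordinate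
subspaces, each of which needs at most `(3 / δ) ^ s` net points, and counting the subspaces
contributes the `e`. The sparse regression bound uses only the value of `log C`, not the covering
property.

For sparse regression, suppose every unit vector is within `ρ` of a ray spanned by a code. Greedy
matching pursuit then shrinks the residual by a factor `ρ` per step, so `s` steps leave an error of
at most `ρ ^ s`. Take `ρ = d ^ (-κp / (d - 1))`; the lower bound on `s` gives `ρ ^ s ≤ δ`
(`exp_pow_le_of_sparsity`). A Gaussian code falls in the cone around a given direction with an
explicit probability (`ofReal_le_stdGaussian_cone`), and a union bound over a net of the sphere
treats all directions at once (`gaussianCodes_not_rays_le`). Since `m ≥ X * D` with `X = (4 / δ) ^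
p` and `D = d ^ p`, the factor `X ≥ log (2d / ε)` absorbs `ε`, while `D` compensates the small cone
probability and pays for the net.

A larger `κ` makes the pursuit converge faster, a smaller one makes the cones likelier: `κ = 0.3`
serves both needs, except when `d = 2` and `δ ≥ 1/2`, where `0.24` is used. Good codes exist because
failure has probability at most `ε < 1`; dimension one is done by hand. -/

/-! ### Nets in the unit ball by volume comparison -/

section Nets

variable {E : Type*} [NormedAddCommGroup E] [NormedSpace ℝ E] [FiniteDimensional ℝ E]

/-- The balls of radius `δ / 2` around the points are disjoint and fit into the ball of radius `1 +
δ / 2`. -/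
lemma card_le_of_separated_of_norm_le_one {δ : ℝ} (hδ : 0 < δ) (T : Finset E)
    (hT : ∀ c ∈ T, ‖c‖ ≤ 1) (hsep : ∀ c ∈ T, ∀ c' ∈ T, c ≠ c' → δ ≤ ‖c - c'‖) :
    (T.card : ℝ) ≤ (1 + 2 / δ) ^ Module.finrank ℝ E := by
  borelize E
  let μ : Measure E := Measure.addHaar
  have hδ2 : 0 < δ / 2 := by positivity
  have hρ : 0 < 1 + δ / 2 := by positivity
  have hdisj : Set.Pairwise (T : Set E) (Function.onFun Disjoint fun c => Metric.ball c (δ / 2)) := by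
    intro c hc c' hc' hcc
    apply Metric.ball_disjoint_ball
    rw [dist_eq_norm]
    linarith [hsep c hc c' hc' hcc]
  have hsub : (⋃ c ∈ T, Metric.ball c (δ / 2)) ⊆ Metric.ball (0 : E) (1 + δ / 2) := by
    refine Set.iUnion₂_subset fun x hx => Metric.ball_subset_ball' ?_
    rw [dist_zero_right]
    linarith [hT x hx]
  have hvol : (T.card : ℝ≥0∞) * ENNReal.ofReal ((δ / 2) ^ Module.finrank ℝ E) * μ (Metric.ball 0 1)
      ≤ ENNReal.ofReal ((1 + δ / 2) ^ Module.finrank ℝ E) * μ (Metric.ball 0 1) := by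
    calc (T.card : ℝ≥0∞) * ENNReal.ofReal ((δ / 2) ^ Module.finrank ℝ E) * μ (Metric.ball 0 1)
        = μ (⋃ c ∈ T, Metric.ball c (δ / 2)) := by
          rw [measure_biUnion_finset hdisj fun c _ => measurableSet_ball]
          simp only [μ.addHaar_ball_of_pos _ hδ2, Finset.sum_const, nsmul_eq_mul, mul_assoc]
      _ ≤ μ (Metric.ball (0 : E) (1 + δ / 2)) := measure_mono hsub
      _ = _ := μ.addHaar_ball_of_pos _ hρ
  have hcard : (T.card : ℝ≥0∞) * ENNReal.ofReal ((δ / 2) ^ Module.finrank ℝ E) ≤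
      ENNReal.ofReal ((1 + δ / 2) ^ Module.finrank ℝ E) :=
    (ENNReal.mul_le_mul_iff_left (Metric.measure_ball_pos _ _ zero_lt_one).ne'
      measure_ball_lt_top.ne).1 hvol
  have hreal := ENNReal.toReal_le_of_le_ofReal (by positivity) hcard
  rw [ENNReal.toReal_mul, ENNReal.toReal_natCast, ENNReal.toReal_ofReal (by positivity),
    ← le_div_iff₀ (by positivity), ← div_pow] at hreal
  refine hreal.trans_eq ?_
  congr 1
  field_simp
  ring

/-- A subset of the unit ball of an `n`-dimensional normed space contains one of its `δ`-nets with at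
most `(1 + 2 / δ) ^ n` elements. -/
lemma exists_net_card_le {δ : ℝ} (hδ : 0 < δ) {A : Set E} (hA : ∀ x ∈ A, ‖x‖ ≤ 1) :
    ∃ T : Finset E, (T : Set E) ⊆ A ∧ (∀ x ∈ A, ∃ y ∈ T, ‖x - y‖ ≤ δ) ∧
      (T.card : ℝ) ≤ (1 + 2 / δ) ^ Module.finrank ℝ E := by
  classical
  -- A separated subset of maximal cardinality is a net: a point far from all of it could be added.
  let S : Set ℕ := {k | ∃ T : Finset E, (T : Set E) ⊆ A ∧
    (∀ c ∈ T, ∀ c' ∈ T, c ≠ c' → δ ≤ ‖c - c'‖) ∧ T.card = k}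
  have hne : S.Nonempty := ⟨0, ∅, by simp⟩
  have hbdd : BddAbove S := by
    refine ⟨⌊(1 + 2 / δ) ^ Module.finrank ℝ E⌋₊, ?_⟩
    rintro k ⟨T, hTA, hsep, rfl⟩
    exact Nat.le_floor (card_le_of_separated_of_norm_le_one hδ T (fun c hc => hA c (hTA hc)) hsep)
  obtain ⟨T, hTA, hsep, hcard⟩ := Nat.sSup_mem hne hbdd
  refine ⟨T, hTA, fun x hx => ?_,
    card_le_of_separated_of_norm_le_one hδ T (fun c hc => hA c (hTA hc)) hsep⟩
  by_contra! hfar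
  have hxT : x ∉ T := fun hxT => by
    have := hfar x hxT
    simp at this
    linarith
  have hmem : T.card + 1 ∈ S := by
    refine ⟨insert x T, ?_, ?_, Finset.card_insert_of_notMem hxT⟩
    · rw [Finset.coe_insert]
      exact Set.insert_subset hx hTA
    · intro c hc c' hc' hcc
      rcases Finset.mem_insert.1 hc with h1 | h1 <;> rcases Finset.mem_insert.1 hc' with h2 | h2
      · exact absurd (h1.trans h2.symm) hcc
      · rw [h1]
        exact (hfar _ h2).le
      · rw [h2, norm_sub_rev]
        exact (hfar _ h1).le
      · exact hsep c h1 c' h2 hcc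
  have := le_csSup hbdd hmem
  omega

end Nets

/-! ### Covering numbers of sparse unit vectors -/

lemma choose_le_exp_mul_div_pow {m s : ℕ} (hs : 1 ≤ s) :
    (m.choose s : ℝ) ≤ (Real.exp 1 * m / s) ^ s := by
  have hs0 : (0 : ℝ) < s := by exact_mod_cast hs
  have h1 := Nat.choose_le_pow_div (α := ℝ) s m
  have h2 := Real.pow_div_factorial_le_exp (s : ℝ) hs0.le s
  calc (m.choose s : ℝ) ≤ (m : ℝ) ^ s / s.factorial := h1
    _ = (m / s : ℝ) ^ s * ((s : ℝ) ^ s / s.factorial) := by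
      rw [div_pow]
      field_simp
    _ ≤ (m / s : ℝ) ^ s * Real.exp s := by gcongr
    _ = _ := by
      rw [← Real.exp_one_pow, ← mul_pow]
      congr 1
      ring

/-- Nets are taken inside each coordinate subspace and among the sparse unit vectors themselves,
because `Metric.coveringNumber` wants its centres in the set. The `3` comes from `1 + 2 / δ ≤ 3 /
δ`. -/
lemma isSparseCoveringConstant_three_mul_exp_one : IsSparseCoveringConstant (3 * Real.exp 1) := by
  classical
  intro m s δ hs hsm hδ hδ1
  have hδ0 : (0 : ℝ) < δ := by exact_mod_cast hδ
  have hδ1' : (δ : ℝ) < 1 := by exact_mod_cast hδ1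
  let e : Fin m → EuclideanSpace ℝ (Fin m) := fun i => EuclideanSpace.single i 1
  let V : Finset (Fin m) → Submodule ℝ (EuclideanSpace ℝ (Fin m)) :=
    fun S => Submodule.span ℝ (S.image e : Finset (EuclideanSpace ℝ (Fin m)))
  have hV : ∀ S, Module.finrank ℝ (V S) ≤ S.card := fun S =>
    (finrank_span_finset_le_card _).trans Finset.card_image_le
  have hnet : ∀ S, ∃ T : Finset (V S), (T : Set (V S)) ⊆ {v | (v : EuclideanSpace ℝ (Fin m)) ∈
      sparseUnitVectors m s} ∧ (∀ x ∈ {v : V S | (v : EuclideanSpace ℝ (Fin m)) ∈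
      sparseUnitVectors m s}, ∃ y ∈ T, ‖x - y‖ ≤ δ) ∧
      (T.card : ℝ) ≤ (1 + 2 / δ) ^ Module.finrank ℝ (V S) := fun S =>
    exists_net_card_le hδ0 fun x hx => by
      exact (show ‖(x : EuclideanSpace ℝ (Fin m))‖ = 1 from hx.1).le
  choose T hTsub hTcov hTcard using hnet
  let N : Finset (EuclideanSpace ℝ (Fin m)) :=
    (Finset.powersetCard s Finset.univ).biUnion fun S => (T S).image Subtype.val
  have hNsub : (N : Set (EuclideanSpace ℝ (Fin m))) ⊆ sparseUnitVectors m s := by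
    intro x hx
    simp only [N, Finset.coe_biUnion, Set.mem_iUnion, Finset.mem_coe, Finset.mem_image] at hx
    obtain ⟨S, -, v, hv, rfl⟩ := hx
    exact hTsub S hv
  have hNcov : Metric.IsCover δ (sparseUnitVectors m s) (N : Set (EuclideanSpace ℝ (Fin m))) := by
    intro x hx
    have hcard : (Finset.univ.filter fun i => x i ≠ 0).card ≤ s := by
      have := hx.2
      rwa [Set.ncard_eq_toFinset_card', Set.toFinset_ofPred] at this
    -- A smaller support is enlarged to exactly `s` indices, so that only `m.choose s` subspaces are
    -- counted.
    obtain ⟨S, hxS, hS⟩ := Finset.exists_superset_card_eq hcard (by simpa using hsm)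
    have hxV : x ∈ V S := by
      have hsum : x = ∑ i ∈ S, x i • e i := by
        ext j
        simp only [e, WithLp.ofLp_sum, WithLp.ofLp_smul, Finset.sum_apply, Pi.smul_apply,
          PiLp.ofLp_single, Pi.single_apply, smul_eq_mul, mul_ite, mul_one, mul_zero,
          Finset.sum_ite_eq]
        split_ifs with hj
        · rfl
        · by_contra h
          exact hj (hxS (by simpa using h))
      rw [hsum]
      exact Submodule.sum_mem _ fun i hi => Submodule.smul_mem _ _
        (Submodule.subset_span (by simpa using ⟨i, hi, rfl⟩))
    obtain ⟨y, hy, hxy⟩ := hTcov S ⟨x, hxV⟩ hx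
    refine ⟨y, ?_, ?_⟩
    · simp only [N, Finset.coe_biUnion, Set.mem_iUnion, Finset.mem_coe, Finset.mem_image]
      exact ⟨S, Finset.mem_powersetCard_univ.2 hS, y, hy, rfl⟩
    · simp only [Set.mem_ofPred_eq]
      rw [edist_dist, dist_eq_norm, ← ENNReal.ofReal_coe_nnreal]
      exact ENNReal.ofReal_le_ofReal hxy
  have hNcard : (N.card : ℝ) ≤ (3 * Real.exp 1 * m / (s * δ)) ^ s := by
    have hle : ∀ S ∈ Finset.powersetCard s (Finset.univ : Finset (Fin m)),
        (((T S).image Subtype.val).card : ℝ) ≤ (3 / δ) ^ s := by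
      intro S hS
      have hbase : 1 + 2 / (δ : ℝ) ≤ 3 / δ := by
        rw [← sub_nonneg]
        have : 3 / (δ : ℝ) - (1 + 2 / δ) = (1 - δ) / δ := by
          field_simp
          ring
        rw [this]
        exact div_nonneg (by linarith) hδ0.le
      calc (((T S).image Subtype.val).card : ℝ) ≤ (T S).card := by
            exact_mod_cast Finset.card_image_le
        _ ≤ (1 + 2 / δ) ^ Module.finrank ℝ (V S) := hTcard S
        _ ≤ (1 + 2 / δ) ^ s := by
            refine pow_le_pow_right₀ ?_ ((hV S).trans_eq (Finset.mem_powersetCard_univ.1 hS))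
            have : (0 : ℝ) ≤ 2 / δ := by positivity
            linarith
        _ ≤ (3 / δ) ^ s := by gcongr
    calc (N.card : ℝ) ≤ ∑ S ∈ Finset.powersetCard s (Finset.univ : Finset (Fin m)),
          (((T S).image Subtype.val).card : ℝ) := by exact_mod_cast Finset.card_biUnion_le
      _ ≤ ∑ S ∈ Finset.powersetCard s (Finset.univ : Finset (Fin m)), (3 / (δ : ℝ)) ^ s :=
          Finset.sum_le_sum hle
      _ = m.choose s * (3 / (δ : ℝ)) ^ s := by simp
      _ ≤ (Real.exp 1 * m / s) ^ s * (3 / (δ : ℝ)) ^ s := by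
          gcongr
          exact choose_le_exp_mul_div_pow hs
      _ = _ := by
          rw [← mul_pow]
          congr 1
          field_simp
  calc ((Metric.coveringNumber δ (sparseUnitVectors m s) : ℕ∞) : ℝ≥0∞)
      ≤ (((N : Set (EuclideanSpace ℝ (Fin m))).encard : ℕ∞) : ℝ≥0∞) := by
        exact_mod_cast hNcov.coveringNumber_le_encard hNsub
    _ = ENNReal.ofReal N.card := by simp
    _ ≤ _ := ENNReal.ofReal_le_ofReal hNcard

/-! ### Lower bound for clustering -/

lemma ofReal_one_div_pow_le_clusteringT {d : ℕ} {δ : ℝ} (hδ : 0 < δ) :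
    ENNReal.ofReal (1 / δ ^ d) ≤ ((clusteringT d δ : ℕ∞) : ℝ≥0∞) := by
  have key : ∀ m : ℕ, (∃ z : Fin m → EuclideanSpace ℝ (Fin d),
      ApproximatesBall δ (clusteringOutputs z)) → 1 / δ ^ d ≤ (m : ℝ) := by
    rintro m ⟨z, hz⟩
    let μ : Measure (EuclideanSpace ℝ (Fin d)) := volume
    have hsub : Metric.ball (0 : EuclideanSpace ℝ (Fin d)) 1 ⊆ ⋃ i, Metric.ball (z i) δ := by
      intro x hx
      obtain ⟨_, ⟨i, rfl⟩, hi⟩ := hz x (Metric.ball_subset_closedBall hx)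
      exact Set.mem_iUnion.2 ⟨i, by rwa [Metric.mem_ball, dist_eq_norm]⟩
    have hvol : 1 * μ (Metric.ball 0 1) ≤ (m * ENNReal.ofReal (δ ^ d)) * μ (Metric.ball 0 1) := by
      calc 1 * μ (Metric.ball 0 1) = μ (Metric.ball 0 1) := one_mul _
        _ ≤ μ (⋃ i, Metric.ball (z i) δ) := measure_mono hsub
        _ ≤ ∑ i, μ (Metric.ball (z i) δ) := measure_iUnion_fintype_le _ _
        _ = _ := by
          simp only [μ.addHaar_ball_of_pos _ hδ, Finset.sum_const, nsmul_eq_mul, mul_assoc,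
            finrank_euclideanSpace_fin, Finset.card_univ, Fintype.card_fin]
    have h1 := (ENNReal.mul_le_mul_iff_left (Metric.measure_ball_pos _ _ zero_lt_one).ne'
      measure_ball_lt_top.ne).1 hvol
    have h2 := ENNReal.toReal_mono (by finiteness) h1
    rw [ENNReal.toReal_mul, ENNReal.toReal_natCast, ENNReal.toReal_ofReal (by positivity),
      ENNReal.toReal_one] at h2
    rwa [div_le_iff₀ (by positivity)]
  have hle : ((⌈1 / δ ^ d⌉₊ : ℕ) : ℕ∞) ≤ clusteringT d δ :=
    le_iInf fun m => le_iInf fun hm => by exact_mod_cast Nat.ceil_le.2 (key m hm)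
  calc ENNReal.ofReal (1 / δ ^ d) ≤ ENNReal.ofReal (⌈1 / δ ^ d⌉₊ : ℝ) :=
        ENNReal.ofReal_le_ofReal (Nat.le_ceil _)
    _ = (((⌈1 / δ ^ d⌉₊ : ℕ) : ℕ∞) : ℝ≥0∞) := by simp
    _ ≤ _ := by exact_mod_cast hle

/-! ### Matching pursuit and dimension one -/

/-- Matching pursuit: if every unit vector is within `ρ` of the ray spanned by some code, then `k`
steps leave a residual of at most `ρ ^ k` times the norm. -/
lemma exists_sparse_combination_of_rays {E : Type*} [NormedAddCommGroup E] [NormedSpace ℝ E]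
    {m : ℕ} {u : Fin m → E} {ρ : ℝ} (hρ : 0 ≤ ρ)
    (hu : ∀ x : E, ‖x‖ = 1 → ∃ i, ∃ c : ℝ, 0 ≤ c ∧ ‖x - c • u i‖ ≤ ρ) (k : ℕ) (x : E) :
    ∃ w : Fin m → ℝ, (∀ i, 0 ≤ w i) ∧ {i | w i ≠ 0}.ncard ≤ k ∧
      ‖x - ∑ i, w i • u i‖ ≤ ρ ^ k * ‖x‖ := by
  classical
  induction k with
  | zero => exact ⟨0, by simp, by simp, by simp⟩
  | succ k ih =>
    obtain ⟨w, hw, hcard, hle⟩ := ih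
    set r := x - ∑ i, w i • u i with hr
    rcases eq_or_ne r 0 with h0 | h0
    · refine ⟨w, hw, by omega, ?_⟩
      rw [← hr, h0, norm_zero]
      positivity
    · have hr0 : 0 < ‖r‖ := norm_pos_iff.2 h0
      obtain ⟨i, c, hc, hi⟩ := hu (‖r‖⁻¹ • r) (by
        rw [norm_smul, norm_inv, norm_norm, inv_mul_cancel₀ hr0.ne'])
      -- The new weight is added to any weight that `i` already has, so the support grows by at most
      -- one.
      refine ⟨w + (Pi.single i (‖r‖ * c) : Fin m → ℝ), fun j => ?_, ?_, ?_⟩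
      · have : 0 ≤ (Pi.single i (‖r‖ * c) : Fin m → ℝ) j := by
          rw [Pi.single_apply]
          split_ifs <;> positivity
        exact add_nonneg (hw j) this
      · have hsub : {j | (w + (Pi.single i (‖r‖ * c) : Fin m → ℝ)) j ≠ 0} ⊆ insert i {j | w j ≠ 0} := by
          intro j hj
          by_cases hji : j = i
          · exact Or.inl hji
          · right
            simpa [Pi.single_apply, hji] using hj
        exact (Set.ncard_le_ncard hsub (Set.toFinite _)).trans
          ((Set.ncard_insert_le _ _).trans (by omega))
      · have hsum : ∑ j, (w + (Pi.single i (‖r‖ * c) : Fin m → ℝ)) j • u j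
            = ∑ j, w j • u j + (‖r‖ * c) • u i := by
          simp [add_smul, Finset.sum_add_distrib, Pi.single_apply, ite_smul]
        have hres : x - ∑ j, (w + (Pi.single i (‖r‖ * c) : Fin m → ℝ)) j • u j
            = ‖r‖ • (‖r‖⁻¹ • r - c • u i) := by
          rw [hsum, ← sub_sub, ← hr, smul_sub, smul_smul, smul_smul, mul_inv_cancel₀ hr0.ne',
            one_smul]
        rw [hres, norm_smul, norm_norm]
        calc ‖r‖ * ‖‖r‖⁻¹ • r - c • u i‖ ≤ (ρ ^ k * ‖x‖) * ρ := by gcongr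
          _ = _ := by ring

lemma approximatesBall_sparseOutputs_of_rays {d m s : ℕ} {u : Fin m → EuclideanSpace ℝ (Fin d)}
    {ρ δ : ℝ} (hρ : 0 ≤ ρ) (hδ : ρ ^ s < δ)
    (hu : ∀ x : EuclideanSpace ℝ (Fin d), ‖x‖ = 1 → ∃ i, ∃ c : ℝ, 0 ≤ c ∧ ‖x - c • u i‖ ≤ ρ) :
    ApproximatesBall δ (sparseOutputs s u) := by
  intro x hx
  obtain ⟨w, hw, hcard, hle⟩ := exists_sparse_combination_of_rays hρ hu s x
  refine ⟨_, ⟨w, hw, hcard, rfl⟩, hle.trans_lt (lt_of_le_of_lt ?_ hδ)⟩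
  have hx1 : ‖x‖ ≤ 1 := by simpa using hx
  exact mul_le_of_le_one_right (by positivity) hx1

lemma sparseT_le_of_approximatesBall {d m s : ℕ} {δ : ℝ} {u : Fin m → EuclideanSpace ℝ (Fin d)}
    (hu : ApproximatesBall δ (sparseOutputs s u)) : sparseT d s δ ≤ m :=
  iInf₂_le m ⟨u, hu⟩

/-- Two opposite codes represent every vector of the line exactly. The Gaussian argument excludes
this case: its rate divides by `d - 1`. -/
lemma sparseT_one_le {m s : ℕ} {δ : ℝ} (hδ : 0 < δ) (hs : 1 ≤ s) (hm : 2 ≤ m) :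
    sparseT 1 s δ ≤ m := by
  let e : EuclideanSpace ℝ (Fin 1) := EuclideanSpace.single 0 1
  let u : Fin m → EuclideanSpace ℝ (Fin 1) := fun i => if i.1 = 0 then e else -e
  refine sparseT_le_of_approximatesBall (u := u)
    (approximatesBall_sparseOutputs_of_rays le_rfl (by rwa [zero_pow (by omega)]) fun x _ => ?_)
  have hx : x = x 0 • e := by
    ext j
    fin_cases j
    simp [e]
  rcases le_total 0 (x 0) with h | h
  · refine ⟨⟨0, by omega⟩, x 0, h, ?_⟩
    have : u ⟨0, by omega⟩ = e := by simp [u]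
    rw [this, ← hx, sub_self, norm_zero]
  · refine ⟨⟨1, by omega⟩, -x 0, by linarith, ?_⟩
    have : u ⟨1, by omega⟩ = -e := by simp [u]
    rw [this, smul_neg, neg_smul, neg_neg, ← hx, sub_self, norm_zero]

/-! ### Gaussian measure of cones and the union bound -/

/-- Young's inequality `(u + x)² ≤ a x² + a u² / (a - 1)` separates the shift from the integration
variable. The bound is itself Gaussian in `x`, hence integrates exactly over the transverse
coordinates of a cone; `a` trades the constant against the exponent. -/
lemma ofReal_le_gaussianReal_Ioi {a : ℝ} (ha : 1 < a) (x : ℝ) :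
    ENNReal.ofReal (√((a - 1) / a) / 2 * Real.exp (-(a / 2) * x ^ 2)) ≤
      gaussianReal 0 1 (Set.Ioi x) := by
  have ha1 : 0 < a - 1 := by linarith
  have hb : 0 < a / (2 * (a - 1)) := by positivity
  have hshift : gaussianReal 0 1 (Set.Ioi x) = gaussianReal (-x) 1 (Set.Ioi 0) := by
    have h := gaussianReal_map_sub_const (μ := 0) (v := 1) x
    rw [zero_sub] at h
    rw [← h, Measure.map_apply (by fun_prop) measurableSet_Ioi]
    congr 1
    ext y
    simp
  rw [hshift, gaussianReal_apply_eq_integral _ one_ne_zero]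
  refine ENNReal.ofReal_le_ofReal ?_
  have hconst : √((a - 1) / a) / 2 * Real.exp (-(a / 2) * x ^ 2) =
      ∫ u in Set.Ioi (0 : ℝ), ((√(2 * Real.pi))⁻¹ * Real.exp (-(a / 2) * x ^ 2)) *
        Real.exp (-(a / (2 * (a - 1))) * u ^ 2) := by
    rw [integral_const_mul, integral_gaussian_Ioi]
    have : √(Real.pi / (a / (2 * (a - 1)))) = √(2 * Real.pi) * √((a - 1) / a) := by
      rw [← Real.sqrt_mul (by positivity)]
      congr 1
      field_simp
    rw [this]
    have : √(2 * Real.pi) ≠ 0 := by positivity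
    field_simp
  rw [hconst]
  refine integral_mono ?_ ((integrable_gaussianPDFReal _ _).restrict) fun u => ?_
  · exact ((integrable_exp_neg_mul_sq hb).const_mul _).restrict
  · simp only [gaussianPDFReal, NNReal.coe_one, mul_one, mul_assoc, ← Real.exp_add]
    gcongr
    have hsq : 0 ≤ ((a - 1) * x - u) ^ 2 / (2 * (a - 1)) := by positivity
    have : -(u - -x) ^ 2 / 2 - (-(a / 2 * x ^ 2) + -(a / (2 * (a - 1)) * u ^ 2))
        = ((a - 1) * x - u) ^ 2 / (2 * (a - 1)) := by
      field_simp
      ring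
    linarith

lemma integral_exp_neg_mul_sq_gaussianReal {b : ℝ} (hb : 0 ≤ b) :
    ∫ x, Real.exp (-b * x ^ 2) ∂gaussianReal 0 1 = (√(1 + 2 * b))⁻¹ := by
  rw [integral_gaussianReal_eq_integral_smul one_ne_zero]
  have : ∀ x : ℝ, gaussianPDFReal 0 1 x • Real.exp (-b * x ^ 2) =
      (√(2 * Real.pi))⁻¹ * Real.exp (-(1 / 2 + b) * x ^ 2) := by
    intro x
    simp only [gaussianPDFReal, NNReal.coe_one, mul_one, smul_eq_mul, mul_assoc, ← Real.exp_add]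
    congr 2
    ring
  simp_rw [this]
  rw [integral_const_mul, integral_gaussian, ← Real.sqrt_inv, ← Real.sqrt_inv,
    ← Real.sqrt_mul (by positivity)]
  congr 1
  field_simp

lemma integral_exp_neg_mul_sum_sq_pi_gaussianReal {b : ℝ} (hb : 0 ≤ b) (n : ℕ) :
    ∫ v : Fin n → ℝ, Real.exp (-b * ∑ i, v i ^ 2) ∂Measure.pi (fun _ => gaussianReal 0 1) =
      (√(1 + 2 * b))⁻¹ ^ n := by
  simp_rw [Finset.mul_sum, Real.exp_sum]
  rw [integral_fintype_prod_eq_pow (fun x : ℝ => Real.exp (-b * x ^ 2)),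
    integral_exp_neg_mul_sq_gaussianReal hb, Fintype.card_fin]

/-- The Gaussian measure of a circular cone in `ℝ^(n+1)` with axis the first coordinate. -/
lemma ofReal_le_pi_gaussianReal_cone {a κ : ℝ} (ha : 1 < a) (n : ℕ) :
    ENNReal.ofReal (√((a - 1) / a) / 2 * (√(1 + a * κ ^ 2))⁻¹ ^ n) ≤
      Measure.pi (fun _ : Fin (n + 1) => gaussianReal 0 1)
        {x | κ * √(∑ i : Fin n, x i.succ ^ 2) < x 0} := by
  have hmp := measurePreserving_piFinSuccAbove (fun _ : Fin (n + 1) => gaussianReal 0 1) 0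
  let S : Set (ℝ × (Fin n → ℝ)) := {z | κ * √(∑ i : Fin n, z.2 i ^ 2) < z.1}
  have hS : MeasurableSet S := measurableSet_lt (by fun_prop) (by fun_prop)
  have hpre : {x : Fin (n + 1) → ℝ | κ * √(∑ i : Fin n, x i.succ ^ 2) < x 0} =
      MeasurableEquiv.piFinSuccAbove (fun _ => ℝ) 0 ⁻¹' S := by
    ext x
    simp [S, MeasurableEquiv.piFinSuccAbove, Fin.tail]
  -- Fubini with the transverse coordinates fixed: each slice of the cone is a half-line.
  rw [hpre, hmp.measure_preimage hS.nullMeasurableSet, Measure.prod_apply_symm hS]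
  have hint : Integrable (fun v : Fin n → ℝ => Real.exp (-(a / 2 * κ ^ 2) * ∑ i, v i ^ 2))
      (Measure.pi (fun _ => gaussianReal 0 1)) := by
    refine Integrable.of_bound (C := 1)
      (Measurable.aestronglyMeasurable (by fun_prop)) (ae_of_all _ fun v => ?_)
    rw [Real.norm_eq_abs, Real.abs_exp, Real.exp_le_one_iff, neg_mul, neg_nonpos]
    have : 0 ≤ ∑ i, v i ^ 2 := Finset.sum_nonneg fun i _ => sq_nonneg _
    positivity
  have hval : √((a - 1) / a) / 2 * (√(1 + a * κ ^ 2))⁻¹ ^ n =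
      ∫ v : Fin n → ℝ, √((a - 1) / a) / 2 * Real.exp (-(a / 2 * κ ^ 2) * ∑ i, v i ^ 2)
        ∂Measure.pi (fun _ => gaussianReal 0 1) := by
    rw [integral_const_mul, integral_exp_neg_mul_sum_sq_pi_gaussianReal (by positivity)]
    congr 5
    ring
  rw [hval, ofReal_integral_eq_lintegral_ofReal (hint.const_mul _)
    (ae_of_all _ fun v => by positivity)]
  refine lintegral_mono fun v => ?_
  have hv : 0 ≤ ∑ i, v i ^ 2 := Finset.sum_nonneg fun i _ => sq_nonneg _
  have hslice : (fun x => (x, v)) ⁻¹' S = Set.Ioi (κ * √(∑ i, v i ^ 2)) := by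
    ext
    simp [S]
  rw [hslice]
  convert ofReal_le_gaussianReal_Ioi ha (κ * √(∑ i, v i ^ 2)) using 4
  rw [mul_pow, Real.sq_sqrt hv]
  ring

/-- The probability that a standard Gaussian vector lies in the circular cone around a unit vector
`y` whose half-angle has sine `r`. -/
lemma ofReal_le_stdGaussian_cone {n : ℕ} {a r : ℝ} (ha : 1 < a) (hr : 0 < r) (hr1 : r < 1)
    {y : EuclideanSpace ℝ (Fin (n + 1))} (hy : ‖y‖ = 1) :
    ENNReal.ofReal (√((a - 1) / a) / 2 * (√(1 + a * (1 / r ^ 2 - 1)))⁻¹ ^ n) ≤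
      stdGaussian (EuclideanSpace ℝ (Fin (n + 1)))
        {u | 0 < inner ℝ y u ∧ (1 - r ^ 2) * ‖u‖ ^ 2 ≤ inner ℝ y u ^ 2} := by
  have hon : Orthonormal ℝ (Set.domRestrict ({0} : Set (Fin (n + 1))) fun _ => y) := by
    constructor
    · intro i
      simpa using hy
    · intro i j hij
      exact absurd (Subsingleton.elim i j) hij
  obtain ⟨b, hb⟩ := hon.exists_orthonormalBasis_extension_of_card_eq (by simp)
  have hb0 : b 0 = y := hb 0 rfl
  have hr2 : 0 ≤ 1 / r ^ 2 - 1 := by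
    rw [sub_nonneg, le_div_iff₀ (by positivity)]
    nlinarith
  -- In a basis starting with `y` the coordinates are independent standard Gaussians; `κ` is the
  -- cotangent of the half-angle.
  have hcone := ofReal_le_pi_gaussianReal_cone (κ := √(1 / r ^ 2 - 1)) ha n
  rw [Real.sq_sqrt hr2] at hcone
  rw [stdGaussian_eq_map_pi_orthonormalBasis b]
  refine hcone.trans ((measure_mono ?_).trans
    (Measure.le_map_apply (Measurable.aemeasurable (by fun_prop)) _))
  intro x hx
  simp only [Set.mem_ofPred_eq, Set.mem_preimage] at hx ⊢
  set q := ∑ i : Fin n, x i.succ ^ 2 with hq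
  have hq0 : 0 ≤ q := Finset.sum_nonneg fun i _ => sq_nonneg _
  have hx0 : 0 < x 0 := lt_of_le_of_lt (by positivity) hx
  have hnorm : ‖∑ i, x i • b i‖ ^ 2 = x 0 ^ 2 + q := by
    rw [← b.sum_sq_inner_right, Fin.sum_univ_succ]
    simp only [b.orthonormal.inner_right_fintype]
    rfl
  have hinner : inner ℝ y (∑ i, x i • b i) = x 0 := by
    rw [← hb0, b.orthonormal.inner_right_fintype]
  rw [hinner, hnorm]
  refine ⟨hx0, ?_⟩
  have h1 : (1 / r ^ 2 - 1) * q < x 0 ^ 2 := by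
    have := pow_lt_pow_left₀ hx (by positivity) two_ne_zero
    rwa [mul_pow, Real.sq_sqrt hr2, Real.sq_sqrt hq0] at this
  have h2 := mul_le_mul_of_nonneg_left h1.le (sq_nonneg r)
  have h3 : r ^ 2 * ((1 / r ^ 2 - 1) * q) = (1 - r ^ 2) * q := by
    field_simp
  linarith

/-- Project `y` orthogonally onto the line of `u`; the coefficient is positive, so the projection
lies on the ray. -/
lemma exists_norm_sub_smul_le_of_mem_cone {E : Type*} [NormedAddCommGroup E]
    [InnerProductSpace ℝ E] {y u : E} {r : ℝ} (hr : 0 ≤ r) (hy : ‖y‖ = 1) (hpos : 0 < inner ℝ y u)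
    (hcone : (1 - r ^ 2) * ‖u‖ ^ 2 ≤ inner ℝ y u ^ 2) : ∃ c : ℝ, 0 ≤ c ∧ ‖y - c • u‖ ≤ r := by
  have hu0 : ‖u‖ ≠ 0 := by
    rw [norm_ne_zero_iff]
    rintro rfl
    simp at hpos
  have hu : 0 < ‖u‖ ^ 2 := by positivity
  refine ⟨inner ℝ y u / ‖u‖ ^ 2, by positivity, le_of_sq_le_sq ?_ hr⟩
  rw [norm_sub_sq_real, hy, real_inner_smul_right, norm_smul, mul_pow, Real.norm_eq_abs, sq_abs]
  have h : 1 ^ 2 - 2 * (inner ℝ y u / ‖u‖ ^ 2 * inner ℝ y u) +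
      (inner ℝ y u / ‖u‖ ^ 2) ^ 2 * ‖u‖ ^ 2 = (‖u‖ ^ 2 - inner ℝ y u ^ 2) / ‖u‖ ^ 2 := by
    field_simp
    ring
  rw [h, div_le_iff₀ hu]
  linarith

lemma multivariateGaussian_zero_smul_one (d : ℕ) {t : ℝ} (ht : 0 ≤ t) :
    multivariateGaussian 0 (t • (1 : Matrix (Fin d) (Fin d) ℝ)) =
      (stdGaussian (EuclideanSpace ℝ (Fin d))).map (fun x => √t • x) := by
  have : IsProbabilityMeasure ((stdGaussian (EuclideanSpace ℝ (Fin d))).map (fun x => √t • x)) :=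
    Measure.isProbabilityMeasure_map (by fun_prop)
  refine Measure.ext_of_charFun (funext fun x => ?_)
  have hdot : x.ofLp ⬝ᵥ (t • (1 : Matrix (Fin d) (Fin d) ℝ)).mulVec x.ofLp = (‖√t‖ * ‖x‖) ^ 2 := by
    rw [mul_pow, Real.norm_eq_abs, sq_abs, Real.sq_sqrt ht, EuclideanSpace.real_norm_sq_eq,
      Matrix.smul_mulVec, Matrix.one_mulVec, dotProduct_smul, smul_eq_mul]
    simp [dotProduct, pow_two]
  rw [charFun_map_smul, charFun_stdGaussian,
    charFun_multivariateGaussian (Matrix.PosSemidef.one.smul ht), norm_smul, hdot, inner_zero_right]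
  congr 1
  push_cast
  ring

/-- The cone is invariant under positive scaling, so the covariance factor `1 / m` plays no role;
then `1 - q ≤ exp (-q)`. -/
lemma multivariateGaussian_not_ray_le {n m : ℕ} (hm : 0 < m) {a r : ℝ} (ha : 1 < a) (hr : 0 < r)
    (hr1 : r < 1) {y : EuclideanSpace ℝ (Fin (n + 1))} (hy : ‖y‖ = 1) :
    multivariateGaussian 0 ((m : ℝ)⁻¹ • (1 : Matrix (Fin (n + 1)) (Fin (n + 1)) ℝ))
        {u | ¬ ∃ c : ℝ, 0 ≤ c ∧ ‖y - c • u‖ ≤ r} ≤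
      ENNReal.ofReal (Real.exp
        (-(√((a - 1) / a) / 2 * (√(1 + a * (1 / r ^ 2 - 1)))⁻¹ ^ n))) := by
  set K : Set (EuclideanSpace ℝ (Fin (n + 1))) :=
    {u | 0 < inner ℝ y u ∧ (1 - r ^ 2) * ‖u‖ ^ 2 ≤ inner ℝ y u ^ 2} with hK
  have hKm : MeasurableSet K := by
    have h1 : MeasurableSet {u : EuclideanSpace ℝ (Fin (n + 1)) | 0 < inner ℝ y u} :=
      measurableSet_lt (by fun_prop) (by fun_prop)
    have h2 : MeasurableSet {u : EuclideanSpace ℝ (Fin (n + 1)) |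
        (1 - r ^ 2) * ‖u‖ ^ 2 ≤ inner ℝ y u ^ 2} := measurableSet_le (by fun_prop) (by fun_prop)
    exact h1.inter h2
  have hsub : {u | ¬ ∃ c : ℝ, 0 ≤ c ∧ ‖y - c • u‖ ≤ r} ⊆ Kᶜ := fun u hu hKu =>
    hu (exists_norm_sub_smul_le_of_mem_cone hr.le hy hKu.1 hKu.2)
  have hm0 : (0 : ℝ) < √(m : ℝ)⁻¹ := by positivity
  have hpre : (fun x : EuclideanSpace ℝ (Fin (n + 1)) => √(m : ℝ)⁻¹ • x) ⁻¹' K = K := by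
    ext u
    simp only [hK, Set.mem_preimage, Set.mem_ofPred_eq, real_inner_smul_right, norm_smul, mul_pow,
      Real.norm_eq_abs, sq_abs]
    rw [mul_pos_iff_of_pos_left hm0, mul_left_comm, mul_le_mul_iff_right₀ (by positivity)]
  refine (measure_mono hsub).trans ?_
  rw [prob_compl_eq_one_sub hKm, multivariateGaussian_zero_smul_one _ (by positivity),
    Measure.map_apply (by fun_prop) hKm, hpre]
  refine (tsub_le_tsub_left (ofReal_le_stdGaussian_cone ha hr hr1 hy) 1).trans ?_
  rw [← ENNReal.ofReal_one, ← ENNReal.ofReal_sub _ (by positivity)]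
  exact ENNReal.ofReal_le_ofReal (Real.one_sub_le_exp_neg _)

/-- Union bound over a net of the sphere: the probability that some unit vector is farther than
`r + η` from all rays spanned by the codes. -/
lemma gaussianCodes_not_rays_le {n m : ℕ} (hm : 0 < m) {a r η : ℝ} (ha : 1 < a) (hr : 0 < r)
    (hr1 : r < 1) (hη : 0 < η) :
    gaussianCodes (n + 1) m {u | ¬ ∀ x : EuclideanSpace ℝ (Fin (n + 1)), ‖x‖ = 1 →
        ∃ i, ∃ c : ℝ, 0 ≤ c ∧ ‖x - c • u i‖ ≤ r + η} ≤
      ENNReal.ofReal ((1 + 2 / η) ^ (n + 1) * Real.exp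
        (-(m * (√((a - 1) / a) / 2 * (√(1 + a * (1 / r ^ 2 - 1)))⁻¹ ^ n)))) := by
  set q := √((a - 1) / a) / 2 * (√(1 + a * (1 / r ^ 2 - 1)))⁻¹ ^ n with hq
  obtain ⟨T, hTsub, hTcov, hTcard⟩ := exists_net_card_le hη
    (A := {x : EuclideanSpace ℝ (Fin (n + 1)) | ‖x‖ = 1}) fun x hx => le_of_eq hx
  rw [finrank_euclideanSpace_fin] at hTcard
  let B : EuclideanSpace ℝ (Fin (n + 1)) → Set (EuclideanSpace ℝ (Fin (n + 1))) :=
    fun y => {u | ¬ ∃ c : ℝ, 0 ≤ c ∧ ‖y - c • u‖ ≤ r}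
  have hsub : {u : Fin m → EuclideanSpace ℝ (Fin (n + 1)) |
      ¬ ∀ x : EuclideanSpace ℝ (Fin (n + 1)), ‖x‖ = 1 →
        ∃ i, ∃ c : ℝ, 0 ≤ c ∧ ‖x - c • u i‖ ≤ r + η} ⊆
      ⋃ y ∈ T, Set.univ.pi fun _ => B y := by
    intro u hu
    by_contra hgood
    refine hu fun x hx => ?_
    obtain ⟨y, hy, hxy⟩ := hTcov x hx
    have hyu : u ∉ Set.univ.pi fun _ => B y := fun h => hgood (Set.mem_biUnion hy h)
    simp only [Set.mem_univ_pi, not_forall, B, Set.mem_ofPred_eq, not_not] at hyu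
    obtain ⟨i, c, hc, hle⟩ := hyu
    refine ⟨i, c, hc, ?_⟩
    calc ‖x - c • u i‖ = ‖(y - c • u i) + (x - y)‖ := by
          congr 1
          abel
      _ ≤ r + η := (norm_add_le _ _).trans (add_le_add hle hxy)
  calc gaussianCodes (n + 1) m _ ≤ gaussianCodes (n + 1) m (⋃ y ∈ T, Set.univ.pi fun _ => B y) :=
        measure_mono hsub
    _ ≤ ∑ y ∈ T, gaussianCodes (n + 1) m (Set.univ.pi fun _ => B y) :=
        measure_biUnion_finset_le _ _
    _ ≤ ∑ y ∈ T, ENNReal.ofReal (Real.exp (-(m * q))) := by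
        refine Finset.sum_le_sum fun y hy => ?_
        -- By independence, the probability that all codes miss one direction is an `m`-th power.
        rw [gaussianCodes, Measure.pi_pi, Finset.prod_const, Finset.card_univ, Fintype.card_fin]
        refine (pow_le_pow_left₀ zero_le
          (multivariateGaussian_not_ray_le hm ha hr hr1 (hTsub hy)) m).trans_eq ?_
        rw [← ENNReal.ofReal_pow (Real.exp_pos _).le, ← Real.exp_nat_mul, mul_neg]
    _ = ENNReal.ofReal (T.card * Real.exp (-(m * q))) := by
        rw [Finset.sum_const, nsmul_eq_mul, ENNReal.ofReal_mul (by positivity),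
          ENNReal.ofReal_natCast]
    _ ≤ _ := ENNReal.ofReal_le_ofReal (by gcongr)

/-! ### From sparsity to contraction rate -/

lemma log_three_mul_exp_one_le : Real.log (3 * Real.exp 1) ≤ 2.0987 := by
  rw [Real.log_mul (by norm_num) (Real.exp_pos 1).ne', Real.log_exp]
  linarith [Real.log_three_lt_d9]

lemma log_four_mul {d : ℕ} (hd : 0 < d) : Real.log (4 * d) = 2 * Real.log 2 + Real.log d := by
  have : (0 : ℝ) < d := by exact_mod_cast hd
  rw [Real.log_mul (by norm_num) this.ne', show (4 : ℝ) = 2 ^ 2 by norm_num, Real.log_pow]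
  norm_num

lemma mul_exp_neg_le (x : ℝ) : Real.exp (-x) * x ≤ 0.368 := by
  have h1 := Real.add_one_le_exp (x - 1)
  have h2 : Real.exp (-x) * Real.exp (x - 1) = Real.exp (-1) := by
    rw [← Real.exp_add]
    congr 1
    ring
  have h3 := mul_le_mul_of_nonneg_left h1 (Real.exp_pos (-x)).le
  have h4 := Real.exp_neg_one_lt_d9
  rw [h2] at h3
  norm_num at h3 h4 ⊢
  linarith

/-- The maximum is close to `x = 1.5`. There `exp` is bounded below by the square of a tangent line
of `exp (x / 2)`, which leaves two quadratics to compare. -/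
lemma mul_quadratic_exp_neg_le {x : ℝ} (hx : 0 ≤ x) :
    Real.exp (-x) * x * (2.09 + 4 / 3 * x) ≤ 1.38 := by
  have h1 := Real.add_one_le_exp ((x - 1.5) / 2)
  have h2 : Real.exp 1.5 ^ 2 = Real.exp 1 ^ 3 := by
    rw [← Real.exp_nat_mul, ← Real.exp_nat_mul]
    norm_num
  have h3 : (4.481 : ℝ) ≤ Real.exp 1.5 := by
    refine le_of_sq_le_sq ?_ (Real.exp_pos _).le
    rw [h2]
    calc (4.481 : ℝ) ^ 2 ≤ 2.7182 ^ 3 := by norm_num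
      _ ≤ Real.exp 1 ^ 3 := by
        gcongr
        linarith [Real.exp_one_gt_d9]
  have h4 : Real.exp x = Real.exp 1.5 * Real.exp ((x - 1.5) / 2) ^ 2 := by
    rw [← Real.exp_nat_mul, ← Real.exp_add]
    congr 1
    push_cast
    ring
  have h5 : 4.481 * ((x - 1.5) / 2 + 1) ^ 2 ≤ Real.exp x := by
    rw [h4]
    have : 0 ≤ (x - 1.5) / 2 + 1 := by linarith
    gcongr
  have h6 : x * (2.09 + 4 / 3 * x) ≤ 1.38 * Real.exp x := by
    nlinarith [sq_nonneg (x - 1.28)]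
  rw [mul_assoc, Real.exp_neg, inv_mul_le_iff₀ (Real.exp_pos x)]
  linarith

/-- The number of matching pursuit steps granted by the sparsity bound suffices when each step
contracts by `exp (-(κ p log d / (d - 1)))`. -/
lemma exp_pow_le_of_sparsity {d s : ℕ} {δ p κ : ℝ} (hd : 2 ≤ d) (hδ : 0 < δ) (hδ1 : δ < 1)
    (hp : 3 ≤ p) (hκ : 0 ≤ κ)
    (hrate : δ * -Real.log δ * (Real.log (3 * Real.exp 1) / 3 + Real.log (4 * d) +
      4 / 3 * -Real.log δ) ≤ 4 * κ * (d / (d - 1)) * Real.log d)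
    (hs : 4 * d / (δ * (Real.log (3 * Real.exp 1) + p * Real.log (4 * d) -
      (p + 1) * Real.log δ)) ≤ (s : ℝ)) :
    Real.exp (-(κ * p * Real.log d / (d - 1))) ^ s ≤ δ := by
  have hd2 : (2 : ℝ) ≤ d := by exact_mod_cast hd
  have hd1 : (0 : ℝ) < d - 1 := by linarith
  set x := -Real.log δ with hx
  have hx0 : 0 < x := by
    rw [hx, neg_pos]
    exact Real.log_neg hδ hδ1
  set c := Real.log (3 * Real.exp 1) with hc
  have hc0 : 0 < c := Real.log_pos (by linarith [Real.add_one_le_exp (1 : ℝ)])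
  set l4 := Real.log (4 * d) with hl4
  have hl4pos : 0 < l4 := Real.log_pos (by linarith)
  have hl : 0 < Real.log d := Real.log_pos (by linarith)
  have hL : c + p * l4 - (p + 1) * Real.log δ = c + p * l4 + (p + 1) * x := by
    rw [hx]
    ring
  rw [hL] at hs
  have hLpos : 0 < c + p * l4 + (p + 1) * x := by positivity
  -- Here `p ≥ 3` enters; afterwards `p` factors out, which is why `hrate` does not involve it.
  have hLle : c + p * l4 + (p + 1) * x ≤ p * (c / 3 + l4 + 4 / 3 * x) := by nlinarith
  rw [← Real.exp_nat_mul, ← Real.le_log_iff_exp_le hδ]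
  have key : x ≤ s * (κ * p * Real.log d / (d - 1)) := by
    refine le_trans ?_ (mul_le_mul_of_nonneg_right hs (by positivity))
    rw [div_mul_eq_mul_div, le_div_iff₀ (by positivity)]
    calc x * (δ * (c + p * l4 + (p + 1) * x)) ≤ x * (δ * (p * (c / 3 + l4 + 4 / 3 * x))) := by
          gcongr
      _ = p * (δ * x * (c / 3 + l4 + 4 / 3 * x)) := by ring
      _ ≤ p * (4 * κ * (d / (d - 1)) * Real.log d) := by gcongr
      _ = _ := by ring
  linarith

lemma contraction_rate_general {d : ℕ} {δ : ℝ} (hd : 2 ≤ d) (hδ : 0 < δ) (hδ1 : δ < 1) :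
    δ * -Real.log δ * (Real.log (3 * Real.exp 1) / 3 + Real.log (4 * d) +
      4 / 3 * -Real.log δ) ≤ 4 * 0.3 * (d / (d - 1)) * Real.log d := by
  have hx0 : 0 ≤ -Real.log δ := (neg_pos.2 (Real.log_neg hδ hδ1)).le
  have hexp : Real.exp (-(-Real.log δ)) = δ := by rw [neg_neg, Real.exp_log hδ]
  have h1 := mul_exp_neg_le (-Real.log δ)
  have h2 := mul_quadratic_exp_neg_le hx0
  rw [hexp] at h1 h2
  have hd2 : (2 : ℝ) ≤ d := by exact_mod_cast hd
  have hl : 0 < Real.log d := Real.log_pos (by linarith)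
  have hupper : δ * -Real.log δ * (Real.log (3 * Real.exp 1) / 3 + Real.log (4 * d) +
      4 / 3 * -Real.log δ) ≤ 1.38 + 0.368 * Real.log d := by
    have hc := log_three_mul_exp_one_le
    have h3 : Real.log (3 * Real.exp 1) / 3 + Real.log (4 * d) + 4 / 3 * -Real.log δ ≤
        (2.09 + 4 / 3 * -Real.log δ) + Real.log d := by
      rw [log_four_mul (by omega)]
      linarith [Real.log_two_lt_d9]
    calc _ ≤ δ * -Real.log δ * ((2.09 + 4 / 3 * -Real.log δ) + Real.log d) := by gcongr
      _ = δ * -Real.log δ * (2.09 + 4 / 3 * -Real.log δ) + δ * -Real.log δ * Real.log d := by ring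
      _ ≤ 1.38 + 0.368 * Real.log d := by gcongr
  refine hupper.trans ?_
  have hlog2 := Real.log_two_gt_d9
  -- From `6` on, the factor `d / (d - 1)` may be replaced by `1`; at `d = 5` that already fails.
  by_cases hd6 : 6 ≤ d
  · have hd6' : (6 : ℝ) ≤ d := by exact_mod_cast hd6
    have h6 : Real.log 2 + Real.log 3 ≤ Real.log d := by
      rw [← Real.log_mul (by norm_num) (by norm_num)]
      exact Real.log_le_log (by norm_num) (by linarith)
    have hfrac : (1 : ℝ) ≤ d / (d - 1) := by
      rw [le_div_iff₀ (by linarith)]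
      linarith
    nlinarith [Real.log_three_gt_d9]
  · have h3 := Real.log_three_gt_d9
    have h4 : Real.log 4 = 2 * Real.log 2 := by
      rw [show (4 : ℝ) = 2 ^ 2 by norm_num, Real.log_pow]
      norm_num
    have h5 := Real.log_five_gt_d9
    have hd6' : d < 6 := by omega
    interval_cases d <;> norm_num <;> linarith

/-- With `x = -log δ ≤ log 2 < 1`, the product `δ * x = x * exp (-x)` is still increasing in `x`, so
it is at most its value at `log 2`. This allows a smaller `κ` than the general bound. -/
lemma contraction_rate_two {δ : ℝ} (hδ : 1 / 2 ≤ δ) (hδ1 : δ < 1) :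
    δ * -Real.log δ * (Real.log (3 * Real.exp 1) / 3 + Real.log (4 * (2 : ℕ)) +
      4 / 3 * -Real.log δ) ≤ 4 * 0.24 * ((2 : ℕ) / ((2 : ℕ) - 1)) * Real.log (2 : ℕ) := by
  have hδ0 : 0 < δ := by linarith
  set x := -Real.log δ with hx
  have hx0 : 0 ≤ x := (neg_pos.2 (Real.log_neg hδ0 hδ1)).le
  have hxle : x ≤ Real.log 2 := by
    have := Real.log_le_log (by norm_num) hδ
    rw [one_div, Real.log_inv] at this
    linarith
  have hl1 := Real.log_two_gt_d9
  have hl2 := Real.log_two_lt_d9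
  have hδx : δ * x ≤ 1 / 2 * Real.log 2 := by
    have h1 := Real.add_one_le_exp (x - Real.log 2)
    have h2 : δ * Real.exp (x - Real.log 2) = 1 / 2 := by
      rw [Real.exp_sub, hx, Real.exp_neg, Real.exp_log hδ0, Real.exp_log (by norm_num)]
      field_simp
    have h3 : x ≤ Real.log 2 * (x - Real.log 2 + 1) := by nlinarith
    have h4 : x ≤ Real.log 2 * Real.exp (x - Real.log 2) := by nlinarith
    calc δ * x ≤ δ * (Real.log 2 * Real.exp (x - Real.log 2)) := by gcongr
      _ = Real.log 2 * (δ * Real.exp (x - Real.log 2)) := by ring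
      _ = _ := by
        rw [h2]
        ring
  have hc := log_three_mul_exp_one_le
  have h4 := log_four_mul (d := 2) (by norm_num)
  have hδx0 : 0 ≤ δ * x := by positivity
  push_cast at h4 ⊢
  rw [h4]
  have : Real.log (3 * Real.exp 1) / 3 + (2 * Real.log 2 + Real.log 2) + 4 / 3 * x ≤ 3.71 := by
    linarith
  calc _ ≤ (1 / 2 * Real.log 2) * 3.71 := by
        refine (mul_le_mul_of_nonneg_left this hδx0).trans ?_
        exact mul_le_mul_of_nonneg_right hδx (by norm_num)
    _ ≤ _ := by linarith

/-! ### Numerical conditions of the union bound -/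

/-- Cone radius `(1 - 2τ)ρ` plus net radius `τρ` is `(1 - τ)ρ`, strictly below `ρ`, which makes the
final error strict. In `X * D * q = X + X * (D * q - 1)` the first term covers `log (2d / ε)`, the
second the net. -/
lemma gaussianCodes_not_approximatesBall_le {n m s : ℕ} {δ ε ρ τ a q X D : ℝ} (hm : 0 < m)
    (hs : 1 ≤ s) (hρ : 0 < ρ) (hρ1 : ρ < 1) (hτ : 0 < τ) (hτ1 : τ < 1 / 2) (hρs : ρ ^ s ≤ δ)
    (ha : 1 < a) (hε : 0 < ε) (hq0 : 0 ≤ q) (hX : Real.log (2 * (n + 1 : ℕ) / ε) ≤ X)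
    (hq : q ≤ √((a - 1) / a) / 2 * (√(1 + a * (1 / ((1 - 2 * τ) * ρ) ^ 2 - 1)))⁻¹ ^ n)
    (hXD : X * D ≤ m)
    (hnum : (n + 1 : ℕ) * Real.log (1 + 2 / (τ * ρ)) - Real.log (2 * (n + 1 : ℕ)) ≤
      X * (D * q - 1)) :
    gaussianCodes (n + 1) m {u | ¬ ApproximatesBall δ (sparseOutputs s u)} ≤ ENNReal.ofReal ε := by
  have hr : 0 < (1 - 2 * τ) * ρ := mul_pos (by linarith) hρ
  have hr1 : (1 - 2 * τ) * ρ < 1 := by nlinarith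
  have hη : 0 < τ * ρ := by positivity
  have hsum : (1 - 2 * τ) * ρ + τ * ρ = (1 - τ) * ρ := by ring
  have hlt : ((1 - τ) * ρ) ^ s < δ := by
    rw [mul_pow]
    have h1 : (1 - τ) ^ s < 1 := pow_lt_one₀ (by linarith) (by linarith) (by omega)
    have h2 : 0 < ρ ^ s := by positivity
    nlinarith
  have hprob := gaussianCodes_not_rays_le (n := n) hm ha hr hr1 hη
  rw [hsum] at hprob
  have hsub : {u : Fin m → EuclideanSpace ℝ (Fin (n + 1)) |
      ¬ ApproximatesBall δ (sparseOutputs s u)} ⊆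
      {u | ¬ ∀ x : EuclideanSpace ℝ (Fin (n + 1)), ‖x‖ = 1 →
        ∃ i, ∃ c : ℝ, 0 ≤ c ∧ ‖x - c • u i‖ ≤ (1 - τ) * ρ} := fun u hu hrays =>
    hu (approximatesBall_sparseOutputs_of_rays (mul_nonneg (by linarith) hρ.le) hlt hrays)
  refine (measure_mono hsub).trans (hprob.trans (ENNReal.ofReal_le_ofReal ?_))
  have hbase : 0 < 1 + 2 / (τ * ρ) := by positivity
  have hd : (0 : ℝ) < (n + 1 : ℕ) := by positivity
  rw [Real.log_div (by positivity) hε.ne'] at hX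
  have h1 : X * D * q ≤ m * (√((a - 1) / a) / 2 *
      (√(1 + a * (1 / ((1 - 2 * τ) * ρ) ^ 2 - 1)))⁻¹ ^ n) :=
    mul_le_mul hXD hq hq0 (by positivity)
  rw [← Real.exp_log hbase, ← Real.exp_nat_mul, ← Real.exp_add, ← Real.le_log_iff_exp_le hε]
  linarith

/-- The cost of the net is at most linear in `p`; this linear growth of `X` reduces the numerical
conditions to `p = 3`. -/
lemma pow_three_mul_le_rpow {B p : ℝ} (hB : 4 ≤ B) (hp : 3 ≤ p) : B ^ 3 * (p / 3) ≤ B ^ p := by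
  have hB0 : 0 < B := by linarith
  have hlog : 1 ≤ Real.log B := by
    rw [Real.le_log_iff_exp_le hB0]
    linarith [Real.exp_one_lt_d9]
  have h1 : B ^ p = B ^ 3 * Real.exp (Real.log B * (p - 3)) := by
    rw [← Real.rpow_def_of_pos hB0, ← Real.rpow_natCast, ← Real.rpow_add hB0]
    congr 1
    push_cast
    ring
  rw [h1]
  have h2 := Real.add_one_le_exp (Real.log B * (p - 3))
  gcongr
  nlinarith

/-- The choice `a = 2` keeps the weight linear in `ρ`, at the price of a constant that is harmless
for a single transverse coordinate. -/
lemma cone_weight_two {τ ρ : ℝ} (hr : 0 < (1 - 2 * τ) * ρ) (hr1 : (1 - 2 * τ) * ρ < 1) :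
    (1 - 2 * τ) / 4 * ρ ≤
      √((2 - 1) / 2) / 2 * (√(1 + 2 * (1 / ((1 - 2 * τ) * ρ) ^ 2 - 1)))⁻¹ ^ 1 := by
  set r := (1 - 2 * τ) * ρ
  have h1 : 1 + 2 * (1 / r ^ 2 - 1) ≤ 2 / r ^ 2 := by
    have : 2 * (1 / r ^ 2) = 2 / r ^ 2 := by ring
    linarith
  have h0 : 0 < 1 + 2 * (1 / r ^ 2 - 1) := by
    have : 1 ≤ 1 / r ^ 2 := by
      rw [le_div_iff₀ (by positivity)]
      nlinarith
    linarith
  have h2 : √(r ^ 2 / 2) ≤ (√(1 + 2 * (1 / r ^ 2 - 1)))⁻¹ := by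
    rw [← Real.sqrt_inv]
    refine Real.sqrt_le_sqrt ?_
    rw [le_inv_comm₀ (by positivity) h0, inv_div]
    exact h1
  rw [pow_one]
  calc (1 - 2 * τ) / 4 * ρ = √((2 - 1) / 2) / 2 * √(r ^ 2 / 2) := by
        have h3 : √((2 - 1) / 2) * √(r ^ 2 / 2) = r / 2 := by
          rw [← Real.sqrt_mul (by norm_num),
            show ((2 : ℝ) - 1) / 2 * (r ^ 2 / 2) = (r / 2) ^ 2 by ring,
            Real.sqrt_sq (by positivity)]
        have h4 : (1 - 2 * τ) / 4 * ρ = r / 4 := by ring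
        linarith
    _ ≤ _ := by gcongr

/-- For `a = 3/2` the base is at most `1 / r ^ 3`, with tangency at `r = 1`. So no constant is
raised to the power `n`; the price is the exponent `3n / 2` of `r` instead of `n`. -/
lemma cone_weight_general {n : ℕ} {t ρ : ℝ} (hρ : 0 < ρ) (hρ1 : ρ < 1) (ht1 : t < 1)
    (ht : 0.81 ≤ t ^ (3 * n)) (ht0 : 0 < t) :
    0.259 * √((ρ ^ n) ^ 3) ≤
      √((1.5 - 1) / 1.5) / 2 * (√(1 + 1.5 * (1 / (t * ρ) ^ 2 - 1)))⁻¹ ^ n := by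
  set r := t * ρ with hrdef
  have hr : 0 < r := by positivity
  have hr1 : r < 1 := by nlinarith
  have h1 : 1 + 1.5 * (1 / r ^ 2 - 1) ≤ 1 / r ^ 3 := by
    have : 1 / r ^ 3 - (1 + 1.5 * (1 / r ^ 2 - 1)) = (1 - r) ^ 2 * (2 + r) / (2 * r ^ 3) := by
      field_simp
      ring
    have h2 : 0 ≤ (1 - r) ^ 2 * (2 + r) / (2 * r ^ 3) := by positivity
    linarith
  have h0 : 0 < 1 + 1.5 * (1 / r ^ 2 - 1) := by
    have : 1 ≤ 1 / r ^ 2 := by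
      rw [le_div_iff₀ (by positivity)]
      nlinarith
    linarith
  have h2 : √(r ^ 3) ≤ (√(1 + 1.5 * (1 / r ^ 2 - 1)))⁻¹ := by
    rw [← Real.sqrt_inv]
    refine Real.sqrt_le_sqrt ?_
    rw [le_inv_comm₀ (by positivity) h0, ← one_div]
    exact h1
  have h3 : √(r ^ 3) ^ n = √(t ^ (3 * n)) * √((ρ ^ n) ^ 3) := by
    rw [← Real.sqrt_mul (by positivity), eq_comm, Real.sqrt_eq_iff_mul_self_eq (by positivity)
      (by positivity), ← mul_pow, Real.mul_self_sqrt (by positivity), hrdef]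
    ring
  have h4 : 0.9 ≤ √(t ^ (3 * n)) := Real.le_sqrt_of_sq_le (by norm_num; linarith)
  have h5 : (0.577 : ℝ) ≤ √((1.5 - 1) / 1.5) := Real.le_sqrt_of_sq_le (by norm_num)
  calc 0.259 * √((ρ ^ n) ^ 3) ≤ 0.577 / 2 * (0.9 * √((ρ ^ n) ^ 3)) := by
        have := Real.sqrt_nonneg ((ρ ^ n) ^ 3)
        linarith
    _ ≤ √((1.5 - 1) / 1.5) / 2 * (√(t ^ (3 * n)) * √((ρ ^ n) ^ 3)) := by gcongr
    _ = √((1.5 - 1) / 1.5) / 2 * √(r ^ 3) ^ n := by rw [h3]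
    _ ≤ _ := by gcongr

/-- The numerical condition of the union bound in dimension two. -/
lemma union_bound_condition_two {p κ K F X : ℝ} (hp : 3 ≤ p) (hκ : 0 ≤ κ) (hκ1 : κ ≤ 1)
    (hF : F ≤ Real.exp (3 * (1 - κ) * Real.log 2)) (hK : 0 ≤ K) (hX : K * (p / 3) ≤ X)
    (hnum : 10.99 + (6 * κ - 2) * Real.log 2 ≤ K * (0.245 * F - 1)) (hF1 : 1 ≤ 0.245 * F) :
    2 * Real.log (1 + 2 / (1 / 100 * Real.exp (-(κ * p * Real.log 2)))) - 2 * Real.log 2 ≤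
      X * (Real.exp (p * Real.log 2) * (0.245 * Real.exp (-(κ * p * Real.log 2))) - 1) := by
  have hl := Real.log_two_gt_d9
  have hlog : Real.log (1 + 2 / (1 / 100 * Real.exp (-(κ * p * Real.log 2)))) ≤
      5.495 + κ * p * Real.log 2 := by
    -- The sum is at most `201` times the exponential, below `3 ^ 5`; this yields `5.495`, just
    -- above `5 log 3`.
    have h1 : 1 + 2 / (1 / 100 * Real.exp (-(κ * p * Real.log 2))) ≤
        3 ^ 5 * Real.exp (κ * p * Real.log 2) := by
      have h2 : 1 ≤ Real.exp (κ * p * Real.log 2) := Real.one_le_exp (by positivity)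
      rw [Real.exp_neg]
      have h3 : 2 / (1 / 100 * (Real.exp (κ * p * Real.log 2))⁻¹) =
          200 * Real.exp (κ * p * Real.log 2) := by
        field_simp
        norm_num
      rw [h3]
      linarith
    refine (Real.log_le_log (by positivity) h1).trans ?_
    rw [Real.log_mul (by positivity) (by positivity), Real.log_exp, Real.log_pow]
    push_cast
    linarith [Real.log_three_lt_d9]
  have hexp : Real.exp (p * Real.log 2) * (0.245 * Real.exp (-(κ * p * Real.log 2))) =
      0.245 * Real.exp ((1 - κ) * p * Real.log 2) := by
    rw [mul_left_comm, ← Real.exp_add]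
    congr 2
    ring
  have hFp : F ≤ Real.exp ((1 - κ) * p * Real.log 2) := by
    refine hF.trans (Real.exp_le_exp.2 ?_)
    have : 3 * (1 - κ) ≤ (1 - κ) * p := by nlinarith
    gcongr
  rw [hexp]
  have hp3 : 1 ≤ p / 3 := by linarith
  -- Passing from `p = 3` to `p` multiplies the left side by at most `p / 3`, and `X` is at least `K
  -- * (p / 3)`.
  calc _ ≤ 2 * (5.495 + κ * p * Real.log 2) - 2 * Real.log 2 := by linarith
    _ ≤ p / 3 * (10.99 + (6 * κ - 2) * Real.log 2) := by
        nlinarith [Real.log_two_lt_d9]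
    _ ≤ p / 3 * (K * (0.245 * F - 1)) := by gcongr
    _ = K * (p / 3) * (0.245 * F - 1) := by ring
    _ ≤ X * (0.245 * F - 1) := mul_le_mul_of_nonneg_right hX (by linarith)
    _ ≤ _ := by
        have : 0 ≤ X := le_trans (by positivity) hX
        gcongr

/-- The numerical condition of the union bound in dimension at least three. -/
lemma union_bound_condition_general {n : ℕ} {p X : ℝ} (hn : 2 ≤ n) (hp : 3 ≤ p)
    (hX : 64 * (p / 3) ≤ X) :
    (n + 1 : ℕ) * Real.log (1 + 2 / (1 / (40 * (n + 1 : ℕ)) *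
        Real.exp (-(0.3 * p * Real.log (n + 1 : ℕ) / ((n + 1 : ℕ) - 1))))) -
      Real.log (2 * (n + 1 : ℕ)) ≤
      X * (Real.exp (p * Real.log (n + 1 : ℕ)) *
        (0.259 * Real.exp (-(0.45 * p * Real.log (n + 1 : ℕ)))) - 1) := by
  have hd3 : (3 : ℝ) ≤ (n + 1 : ℕ) := by exact_mod_cast (by omega : 3 ≤ n + 1)
  set d : ℝ := ((n + 1 : ℕ) : ℝ) with hd
  have hd1 : 0 < d - 1 := by linarith
  set l := Real.log d with hl
  have hl3 : 1.0986 ≤ l := by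
    have := Real.log_le_log (by norm_num) hd3
    linarith [Real.log_three_gt_d9]
  have hlog : Real.log (1 + 2 / (1 / (40 * d) * Real.exp (-(0.3 * p * l / (d - 1))))) ≤
      4.3945 + l + 0.3 * p * l / (d - 1) := by
    have h1 : 1 + 2 / (1 / (40 * d) * Real.exp (-(0.3 * p * l / (d - 1)))) ≤
        3 ^ 4 * d * Real.exp (0.3 * p * l / (d - 1)) := by
      have h2 : 1 ≤ Real.exp (0.3 * p * l / (d - 1)) := Real.one_le_exp (by positivity)
      have h3 : 2 / (1 / (40 * d) * Real.exp (-(0.3 * p * l / (d - 1)))) =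
          80 * (d * Real.exp (0.3 * p * l / (d - 1))) := by
        rw [Real.exp_neg]
        field_simp
        norm_num
      have h4 : 1 ≤ d * Real.exp (0.3 * p * l / (d - 1)) := by nlinarith
      rw [h3]
      linarith
    refine (Real.log_le_log (by positivity) h1).trans ?_
    rw [Real.log_mul (by positivity) (by positivity), Real.log_mul (by positivity) (by positivity),
      Real.log_exp, Real.log_pow]
    push_cast
    linarith [Real.log_three_lt_d9]
  have hmain : d * Real.log (1 + 2 / (1 / (40 * d) * Real.exp (-(0.3 * p * l / (d - 1))))) ≤
      p / 3 * (d * (4.3945 + l) + 1.35 * l) := by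
    have hfrac : d / (d - 1) ≤ 1.5 := by
      rw [div_le_iff₀ hd1]
      linarith
    calc _ ≤ d * (4.3945 + l + 0.3 * p * l / (d - 1)) := by gcongr
      _ = d * (4.3945 + l) + 0.3 * p * l * (d / (d - 1)) := by ring
      _ ≤ d * (4.3945 + l) + 0.3 * p * l * 1.5 := by gcongr
      _ ≤ _ := by
        have : 0 ≤ d * (4.3945 + l) := by positivity
        nlinarith
  -- At `p = 3` the exponential is `d * d ^ 0.65`; the tangent of `exp` at `0.7`, close to `0.65 log
  -- 3`, makes the second factor linear in `l`.
  have hgrow : d * (0.603 + 1.3065 * l) ≤ Real.exp (0.55 * p * l) := by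
    have h1 : (2.01 : ℝ) ≤ Real.exp 0.7 := by
      refine le_of_pow_le_pow_left₀ (n := 10) (by norm_num) (Real.exp_pos _).le ?_
      rw [← Real.exp_nat_mul, show ((10 : ℕ) : ℝ) * 0.7 = ((7 : ℕ) : ℝ) * 1 by norm_num,
        Real.exp_nat_mul]
      calc (2.01 : ℝ) ^ 10 ≤ 2.7182 ^ 7 := by norm_num
        _ ≤ Real.exp 1 ^ 7 := by
          gcongr
          linarith [Real.exp_one_gt_d9]
    have h2 := Real.add_one_le_exp (0.65 * l - 0.7)
    have h3 : Real.exp (1.65 * l) = d * (Real.exp 0.7 * Real.exp (0.65 * l - 0.7)) := by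
      rw [← Real.exp_add, ← Real.exp_log (show 0 < d by linarith), ← Real.exp_add, ← hl]
      congr 1
      ring
    have h4 : 2.01 * (0.65 * l - 0.7 + 1) ≤ Real.exp 0.7 * Real.exp (0.65 * l - 0.7) := by
      have : 0 ≤ 0.65 * l - 0.7 + 1 := by linarith
      gcongr
    calc d * (0.603 + 1.3065 * l) ≤ d * (Real.exp 0.7 * Real.exp (0.65 * l - 0.7)) := by
          gcongr
          linarith
      _ = Real.exp (1.65 * l) := h3.symm
      _ ≤ _ := Real.exp_le_exp.2 (by nlinarith)
  have hexp : Real.exp (p * l) * (0.259 * Real.exp (-(0.45 * p * l))) =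
      0.259 * Real.exp (0.55 * p * l) := by
    rw [mul_left_comm, ← Real.exp_add]
    congr 2
    ring
  rw [hexp]
  have hlog2 : 0 ≤ Real.log (2 * d) := Real.log_nonneg (by linarith)
  have hone : d * (4.3945 + l) + 1.35 * l ≤ 64 * (0.259 * Real.exp (0.55 * p * l) - 1) := by
    nlinarith [mul_nonneg (show 0 ≤ d - 3 by linarith) (show 0 ≤ 5.6 + 20.656 * l by linarith)]
  have hnn : 0 ≤ 0.259 * Real.exp (0.55 * p * l) - 1 := by
    have : 0 ≤ d * (4.3945 + l) + 1.35 * l := by positivity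
    linarith
  calc _ ≤ p / 3 * (d * (4.3945 + l) + 1.35 * l) := by linarith
    _ ≤ p / 3 * (64 * (0.259 * Real.exp (0.55 * p * l) - 1)) := by gcongr
    _ = 64 * (p / 3) * (0.259 * Real.exp (0.55 * p * l) - 1) := by ring
    _ ≤ _ := mul_le_mul_of_nonneg_right hX hnn

/-! ### Choice of parameters and conclusion -/

lemma gaussianCodes_not_approximatesBall_le_of_sparsity {d m s : ℕ} {δ ε p : ℝ} (hd : 2 ≤ d)
    (hδ : 0 < δ) (hδ1 : δ < 1) (hε : 0 < ε) (hp : 3 ≤ p) (hs1 : 1 ≤ s)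
    (hX : Real.log (2 * d / ε) ≤ (4 / δ) ^ p)
    (hs : 4 * d / (δ * (Real.log (3 * Real.exp 1) + p * Real.log (4 * d) -
      (p + 1) * Real.log δ)) ≤ (s : ℝ))
    (hm : (4 * d / δ) ^ p ≤ (m : ℝ)) :
    gaussianCodes d m {u | ¬ ApproximatesBall δ (sparseOutputs s u)} ≤ ENNReal.ofReal ε := by
  have hd2 : (2 : ℝ) ≤ d := by exact_mod_cast hd
  have hd0 : (0 : ℝ) < d := by linarith
  have hl : 0 < Real.log d := Real.log_pos (by linarith)
  have hm0 : 0 < m := by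
    have : (0 : ℝ) < m := lt_of_lt_of_le (by positivity) hm
    exact_mod_cast this
  have hXD : (4 / δ) ^ p * Real.exp (p * Real.log d) ≤ m := by
    rw [mul_comm p, ← Real.rpow_def_of_pos hd0, ← Real.mul_rpow (by positivity) hd0.le,
      div_mul_eq_mul_div]
    exact hm
  have hpow : ∀ B : ℝ, 4 ≤ B → B ≤ 4 / δ → B ^ 3 * (p / 3) ≤ (4 / δ) ^ p := fun B hB hBδ =>
    (pow_three_mul_le_rpow hB hp).trans (Real.rpow_le_rpow (by linarith) hBδ (by linarith))
  have h4 : 4 ≤ 4 / δ := by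
    rw [le_div_iff₀ hδ]
    linarith
  rcases Nat.lt_or_ge 2 d with hd3 | hd3
  · obtain ⟨n, rfl⟩ : ∃ n, d = n + 1 := ⟨d - 1, by omega⟩
    have hn : (0 : ℝ) < n := by
      have : 0 < n := by omega
      exact_mod_cast this
    have hρs := exp_pow_le_of_sparsity hd hδ hδ1 hp (by norm_num)
      (contraction_rate_general hd hδ hδ1) hs
    have hexpo : 0 < 0.3 * p * Real.log (n + 1 : ℕ) / ((n + 1 : ℕ) - 1) := by
      have : (0 : ℝ) < (n + 1 : ℕ) - 1 := by linarith
      positivity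
    set ρ := Real.exp (-(0.3 * p * Real.log (n + 1 : ℕ) / ((n + 1 : ℕ) - 1))) with hρdef
    have hρ1 : ρ < 1 := by
      rw [hρdef, Real.exp_lt_one_iff]
      linarith
    have hτd : (1 : ℝ) / (40 * (n + 1 : ℕ)) ≤ 1 / 80 := by
      rw [div_le_div_iff₀ (by positivity) (by norm_num)]
      linarith
    -- With `κ = 0.3`, the cone exponent `3n / 2` gives `d ^ (-0.45p)`, so `D * q` is of order `d ^
    -- (0.55p)`.
    have hρn : √((ρ ^ n) ^ 3) = Real.exp (-(0.45 * p * Real.log (n + 1 : ℕ))) := by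
      rw [hρdef, ← Real.exp_nat_mul, ← Real.exp_nat_mul, Real.sqrt_eq_iff_mul_self_eq
        (Real.exp_pos _).le (Real.exp_pos _).le, ← Real.exp_add]
      congr 1
      push_cast
      rw [add_sub_cancel_right]
      field_simp
      ring
    refine gaussianCodes_not_approximatesBall_le (τ := 1 / (40 * (n + 1 : ℕ))) (a := 1.5)
      (q := 0.259 * Real.exp (-(0.45 * p * Real.log (n + 1 : ℕ)))) hm0 hs1 (Real.exp_pos _) hρ1
      (by positivity) (by linarith) hρs (by norm_num) hε (by positivity) hX ?_ hXD
      (union_bound_condition_general (by omega) hp ?_)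
    · rw [← hρn]
      refine cone_weight_general (Real.exp_pos _) hρ1 ?_ ?_ (by linarith)
      · have : (0 : ℝ) < 1 / (40 * (n + 1 : ℕ)) := by positivity
        linarith
      · refine le_trans ?_ (one_add_mul_le_pow (a := -2 * (1 / (40 * (n + 1 : ℕ)) : ℝ))
          (by linarith) (3 * n) |>.trans_eq ?_)
        · have : (n : ℝ) * (1 / (40 * (n + 1 : ℕ))) ≤ 1 / 40 := by
            rw [mul_one_div, div_le_div_iff₀ (by positivity) (by norm_num)]
            push_cast
            linarith
          push_cast at this ⊢
          linarith
        · congr 1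
          ring
    · have := hpow 4 le_rfl h4
      norm_num at this
      exact this
  · obtain rfl : d = 2 := by omega
    have key : ∀ κ K F : ℝ, 0 < κ → κ ≤ 1 →
        δ * -Real.log δ * (Real.log (3 * Real.exp 1) / 3 + Real.log (4 * (2 : ℕ)) +
          4 / 3 * -Real.log δ) ≤ 4 * κ * ((2 : ℕ) / ((2 : ℕ) - 1)) * Real.log (2 : ℕ) →
        F ≤ Real.exp (3 * (1 - κ) * Real.log 2) → 0 ≤ K → K * (p / 3) ≤ (4 / δ) ^ p →
        10.99 + (6 * κ - 2) * Real.log 2 ≤ K * (0.245 * F - 1) → 1 ≤ 0.245 * F →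
        gaussianCodes 2 m {u | ¬ ApproximatesBall δ (sparseOutputs s u)} ≤ ENNReal.ofReal ε := by
      intro κ K F hκ hκ1 hrate hF hK hKX hnum hF1
      have hρs := exp_pow_le_of_sparsity hd hδ hδ1 hp hκ.le hrate hs
      have hexpo : κ * p * Real.log (2 : ℕ) / ((2 : ℕ) - 1) = κ * p * Real.log 2 := by
        norm_num
      rw [hexpo] at hρs
      have hρ1 : Real.exp (-(κ * p * Real.log 2)) < 1 := by
        rw [Real.exp_lt_one_iff]
        have : 0 < κ * p * Real.log 2 := by positivity
        linarith
      have hρ := Real.exp_pos (-(κ * p * Real.log 2))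
      refine gaussianCodes_not_approximatesBall_le (n := 1) (τ := 1 / 100) (a := 2)
        (q := 0.245 * Real.exp (-(κ * p * Real.log 2))) hm0 hs1 hρ hρ1 (by norm_num) (by norm_num)
        hρs (by norm_num) hε (by positivity) hX ?_ hXD ?_
      · refine le_trans (le_of_eq ?_) (cone_weight_two (by positivity) (by linarith))
        norm_num
      · have h := union_bound_condition_two hp hκ.le hκ1 hF hK hKX hnum hF1
        have hlog4 : Real.log (2 * (1 + 1 : ℕ)) = 2 * Real.log 2 := by
          rw [show (2 : ℝ) * (1 + 1 : ℕ) = 2 ^ 2 by norm_num, Real.log_pow]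
          norm_num
        rw [hlog4]
        exact_mod_cast h
    have hl1 := Real.log_two_gt_d9
    have hl2 := Real.log_two_lt_d9
    have hfour : ∀ t : ℝ, 4 * Real.exp (t * Real.log 2) = Real.exp ((2 + t) * Real.log 2) := by
      intro t
      rw [add_mul, Real.exp_add, mul_comm 2 (Real.log 2), Real.exp_mul (Real.log 2) 2,
        Real.exp_log (by norm_num)]
      norm_num
    -- For `δ ≤ 1/2`, `X` is at least `8 ^ p`, whence `K = 8 ^ 3`. Otherwise only `K = 4 ^ 3` is
    -- available, too little for `κ = 0.3`. The values `F` lie just below `2 ^ 2.1` and `2 ^ 2.28`.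
    rcases le_total δ (1 / 2) with hδ2 | hδ2
    · refine key 0.3 512 4.27 (by norm_num) (by norm_num) (contraction_rate_general hd hδ hδ1) ?_
        (by norm_num) ?_ (by linarith) (by norm_num)
      · have h1 := Real.add_one_le_exp (0.1 * Real.log 2)
        have h2 := hfour 0.1
        norm_num at h1 h2 ⊢
        linarith
      · have h8 : 8 ≤ 4 / δ := by
          rw [le_div_iff₀ hδ]
          linarith
        have := hpow 8 (by norm_num) h8
        norm_num at this
        exact this
    · refine key 0.24 64 4.85 (by norm_num) (by norm_num) (contraction_rate_two hδ2 hδ1) ?_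
        (by norm_num) ?_ (by linarith) (by norm_num)
      · have h1 := Real.quadratic_le_exp_of_nonneg (show 0 ≤ 0.28 * Real.log 2 by positivity)
        have h2 := hfour 0.28
        have h3 : (0.28 * 0.6931) ^ 2 ≤ (0.28 * Real.log 2) ^ 2 := by gcongr; linarith
        norm_num at h1 h2 h3 ⊢
        linarith
      · have := hpow 4 le_rfl h4
        norm_num at this
        exact this

theorem theorem1 :
    -- clustering
    (∀ (d : ℕ) (δ : ℝ), 1 ≤ d → 0 < δ →
      ENNReal.ofReal (1 / δ ^ d) ≤ ((clusteringT d δ : ℕ∞) : ℝ≥0∞)) ∧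
    -- sparse regression
    (∃ C : ℝ, 0 < C ∧ IsSparseCoveringConstant C ∧
      ∀ (d : ℕ) (δ ε p : ℝ) (s : ℕ), 1 ≤ d → 0 < δ → δ < 1 → 0 < ε → ε < 1 →
        max 3 (Real.log (Real.log (2 * d / ε)) / Real.log (4 / δ)) ≤ p →
        4 * d / (δ * (Real.log C + p * Real.log (4 * d) - (p + 1) * Real.log δ)) ≤ (s : ℝ) →
        sparseT d s δ ≤ (⌈(4 * d / δ) ^ p⌉₊ : ℕ∞) ∧
        (2 ≤ d → ∀ m : ℕ, (4 * d / δ) ^ p ≤ (m : ℝ) →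
          gaussianCodes d m {u | ¬ ApproximatesBall δ (sparseOutputs s u)} ≤
            ENNReal.ofReal ε)) := by
  refine ⟨fun d δ _ hδ => ofReal_one_div_pow_le_clusteringT hδ, 3 * Real.exp 1, by positivity,
    isSparseCoveringConstant_three_mul_exp_one, ?_⟩
  intro d δ ε p s hd hδ hδ1 hε hε1 hp hs
  have hd1 : (1 : ℝ) ≤ d := by exact_mod_cast hd
  have hp3 : 3 ≤ p := (le_max_left _ _).trans hp
  -- This is the second term of the maximum, exponentiated once.
  have hX : Real.log (2 * d / ε) ≤ (4 / δ) ^ p := by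
    have hB : 1 < 4 / δ := by
      rw [lt_div_iff₀ hδ]
      linarith
    have hlog : 0 < Real.log (2 * d / ε) := Real.log_pos (by
      rw [lt_div_iff₀ hε]
      linarith)
    have h1 := (div_le_iff₀ (Real.log_pos hB)).1 ((le_max_right _ _).trans hp)
    rw [Real.rpow_def_of_pos (by positivity), ← Real.log_le_iff_le_exp hlog]
    linarith
  have hs1 : 1 ≤ s := by
    have hc : 0 < Real.log (3 * Real.exp 1) :=
      Real.log_pos (by linarith [Real.add_one_le_exp (1 : ℝ)])
    have hl4 : 0 < Real.log (4 * d) := Real.log_pos (by linarith)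
    have hlδ : Real.log δ < 0 := Real.log_neg hδ hδ1
    have hL : 0 < Real.log (3 * Real.exp 1) + p * Real.log (4 * d) - (p + 1) * Real.log δ := by
      have h1 : 0 < p * Real.log (4 * d) := by positivity
      have h2 : (p + 1) * Real.log δ < 0 := mul_neg_of_pos_of_neg (by linarith) hlδ
      linarith
    have : (0 : ℝ) < s := lt_of_lt_of_le (by positivity) hs
    exact_mod_cast this
  have hprob : 2 ≤ d → ∀ m : ℕ, (4 * d / δ) ^ p ≤ (m : ℝ) →
      gaussianCodes d m {u | ¬ ApproximatesBall δ (sparseOutputs s u)} ≤ ENNReal.ofReal ε :=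
    fun hd2 m hm =>
      gaussianCodes_not_approximatesBall_le_of_sparsity hd2 hδ hδ1 hε hp3 hs1 hX hs hm
  refine ⟨?_, hprob⟩
  rcases hd.eq_or_lt with rfl | hd2
  · refine sparseT_one_le hδ hs1 ?_
    have h4 : 4 ≤ 4 * ((1 : ℕ) : ℝ) / δ := by
      rw [le_div_iff₀ hδ]
      push_cast
      linarith
    have h := pow_three_mul_le_rpow h4 hp3
    have h64 : (4 : ℝ) ^ 3 ≤ (4 * ((1 : ℕ) : ℝ) / δ) ^ 3 := by gcongr
    have h2 : ((2 : ℕ) : ℝ) ≤ (4 * ((1 : ℕ) : ℝ) / δ) ^ p := by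
      push_cast at h h64 ⊢
      nlinarith
    exact_mod_cast h2.trans (Nat.le_ceil _)
  · have hle := hprob hd2 ⌈(4 * d / δ) ^ p⌉₊ (Nat.le_ceil _)
    have hprobm : IsProbabilityMeasure (gaussianCodes d ⌈(4 * d / δ) ^ p⌉₊) := by
      unfold gaussianCodes
      infer_instance
    -- If no codes worked, the bad event would be the whole space, of measure `1 > ε`.
    by_contra hnot
    have huniv : {u : Fin ⌈(4 * d / δ) ^ p⌉₊ → EuclideanSpace ℝ (Fin d) |
        ¬ ApproximatesBall δ (sparseOutputs s u)} = Set.univ :=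
      Set.eq_univ_of_forall fun u hu => hnot (sparseT_le_of_approximatesBall hu)
    rw [huniv, measure_univ, ENNReal.one_le_ofReal] at hle
    linarith
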